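/- Let $p\ge 1$ and $n\ge 1$ be integers, let $m=2n-1$, and let $L^m_p=S^m/\mathbb Z_p$ be a lens space, i.e. the orbit space of the unit sphere $S^m\subset\mathbb C^n$ under a $\mathbb C$-linear action of the cyclic group $\mathbb Z_p$ that preserves $S^m$ and is free on it. For a topological space $X$ let $\mathcal B_k(X)$ be the space of probability measures on $X$ supported on at most $k$ points, with the quotient topology from $\Delta^{k-1}\times X^k$ under $(t,x)\mapsto\sum_i t_i\delta_{x_i}$. Let $P(X)$ be the space of paths $[0,1]\to X$ with the compact-open topology. The distributional topological complexity $\mathrm{dTC}(X)$ is the least integer $k\ge 0$ for which there is a continuous map $\mu: X\times X\to\mathcal B_{k+1}(P(X))$ such that, for all $(x,y)\in X\times X$, the measure $\mu(x,y)$ is supported on paths from $x$ to $y$ ($\mathrm{dTC}(X)=\infty$ if there is no such $k$). Then $$\mathrm{dTC}(L^m_p)\le 2p-1\quad\text{if } p \text{ is odd},\qquad \mathrm{dTC}(L^m_p)\le p-1\quad\text{if } p\text{ is even}.$$ -/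

import Mathlib

noncomputable section

/-- `FinProb n X` (usually written `𝓑_n(X)`): the probability measures on `X` supported on at most
`n` points, recorded by their finitely supported mass functions. -/
def FinProb (n : ℕ) (X : Type*) : Type _ :=
  {μ : X →₀ ℝ // (∀ x, 0 ≤ μ x) ∧ (μ.sum fun _ t => t) = 1 ∧ μ.support.card ≤ n}

namespace FinProb

/-- The measure `t₁ x₁ + ⋯ + tₙ xₙ`, for a point `t` of the standard simplex and an `n`-tuple `x`
of points of `X`. -/
def ofFormalSum {n : ℕ} {X : Type*} (a : stdSimplex ℝ (Fin n) × (Fin n → X)) : FinProb n X :=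
  ⟨∑ i, Finsupp.single (a.2 i) (a.1.1 i), by
    classical
    refine ⟨fun x => ?_, ?_, ?_⟩
    · rw [Finsupp.finsetSum_apply]
      refine Finset.sum_nonneg fun i _ => ?_
      rw [Finsupp.single_apply]
      split_ifs
      · exact a.1.2.1 i
      · exact le_rfl
    · rw [← Finsupp.sum_finsetSum_index (fun _ => rfl) (fun _ _ _ => rfl)]
      simpa using a.1.2.2
    · have h : (∑ i, Finsupp.single (a.2 i) (a.1.1 i)).support ⊆ Finset.univ.image a.2 := by
        refine Finsupp.support_finsetSum.trans (Finset.biUnion_subset.2 fun i _ => ?_)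
        refine Finsupp.support_single_subset.trans ?_
        simp
      exact (Finset.card_le_card h).trans (Finset.card_image_le.trans (by simp))⟩

/-- The quotient topology, coming from the surjection `Δ^{n-1} × Xⁿ → 𝓑_n(X)` that factors through
the `n`-fold join of `X` and the symmetric join. -/
instance instTopologicalSpace (n : ℕ) (X : Type*) [TopologicalSpace X] :
    TopologicalSpace (FinProb n X) :=
  TopologicalSpace.coinduced (ofFormalSum (n := n) (X := X)) inferInstance

/-- The push-forward map `𝓑_n(f) : 𝓑_n(X) → 𝓑_n(Y)`. -/
def map {n : ℕ} {X Y : Type*} (f : X → Y) (μ : FinProb n X) : FinProb n Y :=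
  ⟨μ.1.mapDomain f, by
    classical
    refine ⟨fun y => ?_, ?_, ?_⟩
    · rw [Finsupp.mapDomain, Finsupp.sum, Finsupp.finsetSum_apply]
      refine Finset.sum_nonneg fun i _ => ?_
      rw [Finsupp.single_apply]
      split_ifs
      · exact μ.2.1 i
      · exact le_rfl
    · rw [Finsupp.sum_mapDomain_index (fun _ => rfl) (fun _ _ _ => rfl)]
      exact μ.2.2.1
    · exact (Finset.card_le_card Finsupp.mapDomain_support).trans
        (Finset.card_image_le.trans μ.2.2.2)⟩

/-- The Dirac measure at `x`; the map `X → 𝓑_n(X)` for `n ≥ 1`. -/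
def dirac {n : ℕ} [NeZero n] {X : Type*} (x : X) : FinProb n X :=
  ⟨Finsupp.single x 1, by
    classical
    refine ⟨fun y => ?_, by simp, ?_⟩
    · rw [Finsupp.single_apply]
      split_ifs <;> norm_num
    · exact (Finset.card_le_card Finsupp.support_single_subset).trans
        (by simpa using NeZero.one_le)⟩

end FinProb

/-- `f : X → Y` admits a `𝓑_n`-section: there is a continuous `μ : Y → 𝓑_n(X)` such that
`𝓑_n(f) (μ y)` is the Dirac measure at `y` for every `y`. -/
def AdmitsFinProbSection (n : ℕ) [NeZero n] {X Y : Type*} [TopologicalSpace X] [TopologicalSpace Y]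
    (f : X → Y) : Prop :=
  ∃ μ : Y → FinProb n X, Continuous μ ∧ ∀ y, FinProb.map f (μ y) = FinProb.dirac y

/-- The end-point map on the path space of `X` (continuous maps `[0,1] → X` with the compact-open
topology). -/
def endPoints (X : Type*) [TopologicalSpace X] (γ : C(unitInterval, X)) : X × X :=
  (γ 0, γ 1)

/-- The distributional topological complexity: the least `n` such that the end-point map
of the path space admits a `𝓑_{n+1}`-section, and `⊤` if there is no such `n`. -/
def dTC (X : Type*) [TopologicalSpace X] : ℕ∞ :=
  ⨅ (n : ℕ) (_ : AdmitsFinProbSection (n + 1) (endPoints X)), (n : ℕ∞)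

/-- A complex-linear action of the cyclic group `ℤ/p` on `ℂⁿ` that preserves the unit sphere. -/
abbrev CyclicUnitaryAction (p n : ℕ) : Type :=
  Multiplicative (ZMod p) →*
    (EuclideanSpace ℂ (Fin n) ≃ₗᵢ[ℂ] EuclideanSpace ℂ (Fin n))

/-- The action is free on the unit sphere `S^{2n-1}` of `ℂⁿ`. -/
def IsFreeOnSphere {p n : ℕ} (ρ : CyclicUnitaryAction p n) : Prop :=
  ∀ g, ∀ x ∈ Metric.sphere (0 : EuclideanSpace ℂ (Fin n)) 1, ρ g x = x → g = 1

/-- The orbit relation on the unit sphere. -/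
def sphereOrbitSetoid {p n : ℕ} (ρ : CyclicUnitaryAction p n) :
    Setoid (Metric.sphere (0 : EuclideanSpace ℂ (Fin n)) 1) where
  r x y := ∃ g, ρ g x = y
  iseqv :=
    { refl := fun x => ⟨1, by simp⟩
      symm := by
        rintro x y ⟨g, h⟩
        refine ⟨g⁻¹, ?_⟩
        rw [← h]
        change (ρ g⁻¹ * ρ g) (x : EuclideanSpace ℂ (Fin n)) = x
        rw [← map_mul]
        simp
      trans := by
        rintro x y z ⟨g, h⟩ ⟨k, h'⟩
        refine ⟨k * g, ?_⟩
        rw [map_mul]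
        change ρ k (ρ g x) = z
        rw [h, h'] }

/-- The orbit space of the unit sphere `S^{2n-1}` under the action; when the action is free on the
sphere this is the lens space `L^{2n-1}_p`. -/
def LensSpace {p n : ℕ} (ρ : CyclicUnitaryAction p n) : Type :=
  Quotient (sphereOrbitSetoid ρ)

instance {p n : ℕ} (ρ : CyclicUnitaryAction p n) : TopologicalSpace (LensSpace ρ) :=
  inferInstanceAs (TopologicalSpace (Quotient (sphereOrbitSetoid ρ)))

end

open Topology

/-! Lift a pair of points of the lens space to `x`, `y` on the sphere. Each group element `g` offers
a path from `x` to `ρ g y`: the short great arc, canonical unless `ρ g y = -x`. Weighted by `‖x + ρ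
g y‖`, which vanishes exactly at that bad position, these `p` paths form a measure once the total
weight is positive. Replacing `x`, `y` by other lifts only permutes the indices `g` and translates
the paths, so the measure descends. To have more weights, one may first move from `x` to `c • x`,
with `c` a unit scalar; this commutes with the action because the action is complex linear. The
scalars `1` and `I` give `2p` paths and never lose all weight; for even `p` the scalar `1` suffices
by freeness.

The difficulty is continuity where a weight vanishes, since the arc has no limit there. `midData`
adds the midpoint direction of each arc as extra data, with every limiting direction allowed at
antipodal pairs. This set is closed and the added factor is compact, so it maps onto the product of
lens spaces by a quotient map (`isQuotientMap_midData`). Upstairs the paths are continuous, and the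
ambiguous ones carry weight zero (`midMeasure_eq`). -/

/-- The first projection of a closed subset of a product with a compact space is a quotient map
as soon as it is surjective. -/
theorem IsClosed.isQuotientMap_fst {Z W : Type*} [TopologicalSpace Z] [TopologicalSpace W]
    [CompactSpace W] {E : Set (Z × W)} (hE : IsClosed E) (hsurj : ∀ z, ∃ w, (z, w) ∈ E) :
    IsQuotientMap (fun e : E => e.1.1) := by
  refine IsClosedMap.isQuotientMap ?_ (by fun_prop) fun z => ?_
  · exact isClosedMap_fst_of_compactSpace.comp hE.isClosedMap_subtype_val
  · obtain ⟨w, hw⟩ := hsurj z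
    exact ⟨⟨(z, w), hw⟩, rfl⟩

/-! ### Broken lines avoiding the origin. -/

section Polyline

variable {V : Type*} [NormedAddCommGroup V] [InnerProductSpace ℂ V]

/-- The broken line in `V` through `x`, `c • x`, `m` and `z`, at the times `0`, `1/3`, `2/3`
and `1`. -/
def polyline (c : ℂ) (x m z : V) (t : ℝ) : V :=
  ((max (1 - 3 * t) 0 : ℝ) : ℂ) • x + ((max (1 - |3 * t - 1|) 0 : ℝ) : ℂ) • c • x +
    ((max (1 - |3 * t - 2|) 0 : ℝ) : ℂ) • m + ((max (3 * t - 2) 0 : ℝ) : ℂ) • z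

/-- `m` is a direction of the midpoint of `c • x` and `z`; for `z = -(c • x)` it is any direction
making no obtuse angle with both. -/
structure IsMidDirection (c : ℂ) (x m z : V) : Prop where
  smul_eq : ((‖c • x + z‖ : ℝ) : ℂ) • m = c • x + z
  re_left : 0 ≤ (inner ℂ (c • x) m).re
  re_right : 0 ≤ (inner ℂ m z).re

/-- Pairing a vanishing combination with `u` and with `v` makes sums of nonnegative terms vanish,
which forces `a = b = 0`. -/
theorem smul_add_smul_ne_zero_of_re_inner_nonneg {u v : V} (hu : ‖u‖ = 1) (hv : ‖v‖ = 1)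
    (h : 0 ≤ (inner ℂ u v).re) {a b : ℝ} (ha : 0 ≤ a) (hb : 0 ≤ b) (hab : 0 < a + b) :
    (a : ℂ) • u + (b : ℂ) • v ≠ 0 := by
  intro h0
  have h1 : a + b * (inner ℂ u v).re = 0 := by
    have := congrArg (fun w => (inner ℂ u w).re) h0
    simpa [inner_add_right, inner_smul_right, inner_self_eq_norm_sq_to_K, hu] using this
  have h2 : a * (inner ℂ u v).re + b = 0 := by
    have := congrArg (fun w => (inner ℂ w v).re) h0
    simpa [inner_add_left, inner_smul_left, inner_self_eq_norm_sq_to_K, hv] using this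
  nlinarith [mul_nonneg ha h, mul_nonneg hb h]

theorem polyline_ne_zero {c : ℂ} {x m z : V} (hc : ‖c‖ = 1) (hc' : 0 ≤ c.re) (hx : ‖x‖ = 1)
    (hm : ‖m‖ = 1) (hz : ‖z‖ = 1) (h : IsMidDirection c x m z) (t : ℝ) :
    polyline c x m z t ≠ 0 := by
  have hcx : ‖c • x‖ = 1 := by rw [norm_smul, hc, hx, one_mul]
  have hxc : 0 ≤ (inner ℂ x (c • x)).re := by
    simpa [inner_smul_right, inner_self_eq_norm_sq_to_K, hx] using hc'
  unfold polyline
  -- The coefficients are tent functions of `3 * t`: on each range only two consecutive vertices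
  -- survive, their coefficients add up to at least `1`, and these vertices make no obtuse angle.
  rcases le_total t (1 / 3) with h1 | h1
  · have e1 : max (1 - |3 * t - 2|) 0 = 0 :=
      max_eq_right (by linarith [neg_abs_le (3 * t - 2)])
    have e2 : max (3 * t - 2) 0 = 0 := max_eq_right (by linarith)
    rw [e1, e2, abs_of_nonpos (by linarith : 3 * t - 1 ≤ 0)]
    simp only [Complex.ofReal_zero, zero_smul, add_zero]
    refine smul_add_smul_ne_zero_of_re_inner_nonneg hx hcx hxc (le_max_right _ _)
      (le_max_right _ _) ?_
    have := le_max_left (1 - 3 * t) 0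
    have := le_max_left (1 - -(3 * t - 1)) 0
    linarith
  · have e1 : max (1 - 3 * t) 0 = 0 := max_eq_right (by linarith)
    rw [e1]
    rcases le_total t (2 / 3) with h2 | h2
    · have e2 : max (3 * t - 2) 0 = 0 := max_eq_right (by linarith)
      rw [e2, abs_of_nonneg (by linarith : 0 ≤ 3 * t - 1),
        abs_of_nonpos (by linarith : 3 * t - 2 ≤ 0)]
      simp only [Complex.ofReal_zero, zero_smul, add_zero, zero_add]
      refine smul_add_smul_ne_zero_of_re_inner_nonneg hcx hm h.re_left (le_max_right _ _)
        (le_max_right _ _) ?_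
      have := le_max_left (1 - (3 * t - 1)) 0
      have := le_max_left (1 - -(3 * t - 2)) 0
      linarith
    · have e2 : max (1 - |3 * t - 1|) 0 = 0 :=
        max_eq_right (by linarith [le_abs_self (3 * t - 1)])
      rw [e2, abs_of_nonneg (by linarith : 0 ≤ 3 * t - 2)]
      simp only [Complex.ofReal_zero, zero_smul, zero_add]
      refine smul_add_smul_ne_zero_of_re_inner_nonneg hm hz h.re_right (le_max_right _ _)
        (le_max_right _ _) ?_
      have := le_max_left (1 - (3 * t - 2)) 0
      have := le_max_left (3 * t - 2) 0
      linarith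

theorem polyline_zero (c : ℂ) (x m z : V) : polyline c x m z 0 = x := by
  norm_num [polyline]

theorem polyline_one (c : ℂ) (x m z : V) : polyline c x m z 1 = z := by
  norm_num [polyline]

theorem map_polyline (U : V ≃ₗᵢ[ℂ] V) (c : ℂ) (x m z : V) (t : ℝ) :
    polyline c (U x) (U m) (U z) t = U (polyline c x m z t) := by
  simp only [polyline, map_add, map_smul]

theorem IsMidDirection.map {c : ℂ} {x m z : V} (h : IsMidDirection c x m z) (U : V ≃ₗᵢ[ℂ] V) :
    IsMidDirection c (U x) (U m) (U z) where
  smul_eq := by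
    rw [← map_smul U c x, ← map_add, U.norm_map, ← map_smul, h.smul_eq]
  re_left := by
    rw [← map_smul U c x, U.inner_map_map]
    exact h.re_left
  re_right := by
    rw [U.inner_map_map]
    exact h.re_right

theorem IsMidDirection.unique {c : ℂ} {x m m' z : V} (h : IsMidDirection c x m z)
    (h' : IsMidDirection c x m' z) (h0 : c • x + z ≠ 0) : m = m' :=
  smul_right_injective V (r := ((‖c • x + z‖ : ℝ) : ℂ)) (by simpa using h0)
    (h.smul_eq.trans h'.smul_eq.symm)

theorem exists_isMidDirection {c : ℂ} {x z : V} (hc : ‖c‖ = 1) (hx : ‖x‖ = 1) (hz : ‖z‖ = 1) :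
    ∃ m, ‖m‖ = 1 ∧ IsMidDirection c x m z := by
  have hcx : ‖c • x‖ = 1 := by rw [norm_smul, hc, hx, one_mul]
  rcases eq_or_ne (c • x + z) 0 with h0 | h0
  -- Multiplication by `I` gives a unit vector real-orthogonal to `c • x`, hence also to `z = -(c •
  -- x)`.
  · refine ⟨Complex.I • c • x, by rw [norm_smul, hcx, Complex.norm_I, one_mul], ?_, ?_, ?_⟩
    · simp [h0]
    · rw [inner_smul_right, inner_self_eq_norm_sq_to_K, hcx]
      simp
    · rw [eq_neg_of_add_eq_zero_right h0, inner_neg_right, inner_smul_left,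
        inner_self_eq_norm_sq_to_K, hcx]
      simp
  · have hr : ‖c • x + z‖ ≠ 0 := norm_ne_zero_iff.2 h0
    -- Cauchy–Schwarz: both inner products with the normalized sum have real part a nonnegative
    -- multiple of `1 + re ⟪c • x, z⟫`.
    have hre : -1 ≤ (inner ℂ (c • x) z).re := by
      have := (Complex.abs_re_le_norm _).trans (norm_inner_le_norm (𝕜 := ℂ) (c • x) z)
      rw [hcx, hz, one_mul] at this
      exact (abs_le.1 this).1
    refine ⟨((‖c • x + z‖⁻¹ : ℝ) : ℂ) • (c • x + z), ?_, ?_, ?_, ?_⟩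
    · rw [norm_smul, Complex.norm_real, norm_inv, norm_norm, inv_mul_cancel₀ hr]
    · rw [smul_smul, ← Complex.ofReal_mul, mul_inv_cancel₀ hr, Complex.ofReal_one, one_smul]
    · rw [inner_smul_right, inner_add_right, inner_self_eq_norm_sq_to_K, hcx,
        Complex.re_ofReal_mul]
      refine mul_nonneg (by positivity) ?_
      simp only [RCLike.ofReal_one, one_pow, Complex.add_re, Complex.one_re]
      linarith
    · rw [inner_smul_left, inner_add_left, inner_self_eq_norm_sq_to_K, hz,
        Complex.conj_ofReal, Complex.re_ofReal_mul]
      refine mul_nonneg (by positivity) ?_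
      simp only [RCLike.ofReal_one, one_pow, Complex.add_re, Complex.one_re]
      linarith

end Polyline

/-! ### The quotient map from the sphere to the lens space. -/

section OrbitSpace

variable {p n : ℕ} (ρ : CyclicUnitaryAction p n)

/-- The action on the unit sphere. -/
noncomputable def sphereAct (g : Multiplicative (ZMod p))
    (x : Metric.sphere (0 : EuclideanSpace ℂ (Fin n)) 1) :
    Metric.sphere (0 : EuclideanSpace ℂ (Fin n)) 1 :=
  ⟨ρ g x, by simp⟩

theorem continuous_sphereAct (g : Multiplicative (ZMod p)) : Continuous (sphereAct ρ g) :=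
  ((ρ g).continuous.comp continuous_subtype_val).subtype_mk _

/-- The projection of the unit sphere onto the lens space. -/
noncomputable def LensSpace.mk (x : Metric.sphere (0 : EuclideanSpace ℂ (Fin n)) 1) : LensSpace ρ :=
  Quotient.mk (sphereOrbitSetoid ρ) x

theorem LensSpace.mk_eq_mk_iff {x y : Metric.sphere (0 : EuclideanSpace ℂ (Fin n)) 1} :
    LensSpace.mk ρ x = LensSpace.mk ρ y ↔ ∃ g, sphereAct ρ g x = y := by
  refine Quotient.eq.trans (exists_congr fun g => ?_)
  exact ⟨fun h => Subtype.ext h, fun h => congrArg Subtype.val h⟩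

theorem LensSpace.mk_sphereAct (g : Multiplicative (ZMod p))
    (x : Metric.sphere (0 : EuclideanSpace ℂ (Fin n)) 1) :
    LensSpace.mk ρ (sphereAct ρ g x) = LensSpace.mk ρ x :=
  ((LensSpace.mk_eq_mk_iff ρ).2 ⟨g, rfl⟩).symm

/-- The saturation of an open set is the union of its translates. Openness matters because it makes
the product of two such projections a quotient map again. -/
theorem LensSpace.isOpenQuotientMap_mk : IsOpenQuotientMap (LensSpace.mk ρ) := by
  refine ⟨Quotient.mk_surjective, continuous_quotient_mk', fun U hU => ?_⟩
  refine isOpen_coinduced.2 ?_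
  have h : LensSpace.mk ρ ⁻¹' (LensSpace.mk ρ '' U) = ⋃ g, sphereAct ρ g ⁻¹' U := by
    ext x
    simp only [Set.mem_preimage, Set.mem_image, Set.mem_iUnion]
    constructor
    · rintro ⟨u, hu, hux⟩
      obtain ⟨g, hg⟩ := (LensSpace.mk_eq_mk_iff ρ).1 hux.symm
      exact ⟨g, hg ▸ hu⟩
    · rintro ⟨g, hg⟩
      exact ⟨_, hg, LensSpace.mk_sphereAct ρ g x⟩
  change IsOpen (LensSpace.mk ρ ⁻¹' (LensSpace.mk ρ '' U))
  rw [h]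
  exact isOpen_iUnion fun g => hU.preimage (continuous_sphereAct ρ g)

end OrbitSpace

/-! ### The weighted family of paths and its independence of choices. -/

section Motion

variable {p n N : ℕ} {J : Type*} (ρ : CyclicUnitaryAction p n) (c : J → ℂ)
  (s : Fin N ≃ Multiplicative (ZMod p) × J)

/-- Pairs `(x, y)` of points of the sphere, with a mid direction for `c j • x` and `ρ g y`, for
every `g` and `j`. -/
def midData : Set ((Metric.sphere (0 : EuclideanSpace ℂ (Fin n)) 1 ×
      Metric.sphere (0 : EuclideanSpace ℂ (Fin n)) 1) ×
    (Fin N → Metric.sphere (0 : EuclideanSpace ℂ (Fin n)) 1)) :=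
  {d | ∀ k, IsMidDirection (c (s k).2) (d.1.1 : EuclideanSpace ℂ (Fin n)) (d.2 k)
    (ρ (s k).1 d.1.2)}

theorem isClosed_midData : IsClosed (midData ρ c s) := by
  have h : midData ρ c s = ⋂ k, {d | (((‖c (s k).2 • (d.1.1 : EuclideanSpace ℂ (Fin n)) +
      ρ (s k).1 d.1.2‖ : ℝ) : ℂ) • (d.2 k : EuclideanSpace ℂ (Fin n)) =
        c (s k).2 • (d.1.1 : EuclideanSpace ℂ (Fin n)) + ρ (s k).1 d.1.2) ∧
      0 ≤ (inner ℂ (c (s k).2 • (d.1.1 : EuclideanSpace ℂ (Fin n))) (d.2 k)).re ∧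
      0 ≤ (inner ℂ (d.2 k : EuclideanSpace ℂ (Fin n)) (ρ (s k).1 d.1.2)).re} := by
    ext d
    simp only [Set.mem_iInter]
    exact forall_congr' fun k => ⟨fun h => ⟨h.1, h.2, h.3⟩, fun h => ⟨h.1, h.2.1, h.2.2⟩⟩
  rw [h]
  refine isClosed_iInter fun k => ?_
  have hρ := (ρ (s k).1).continuous
  simp only [Set.ofPred_and]
  refine (isClosed_eq (by fun_prop) (by fun_prop)).inter
    ((isClosed_le continuous_const ?_).inter (isClosed_le continuous_const ?_))
  · exact Complex.continuous_re.comp (Continuous.inner (by fun_prop) (by fun_prop))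
  · exact Complex.continuous_re.comp (Continuous.inner (by fun_prop) (by fun_prop))

theorem exists_mem_midData (hc : ∀ j, ‖c j‖ = 1)
    (z : Metric.sphere (0 : EuclideanSpace ℂ (Fin n)) 1 ×
      Metric.sphere (0 : EuclideanSpace ℂ (Fin n)) 1) : ∃ m, (z, m) ∈ midData ρ c s := by
  have h := fun k : Fin N => exists_isMidDirection (hc (s k).2)
    (norm_eq_of_mem_sphere z.1) (norm_eq_of_mem_sphere (sphereAct ρ (s k).1 z.2))
  choose m hm hm' using h
  exact ⟨fun k => ⟨m k, by simpa using hm k⟩, hm'⟩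

theorem isQuotientMap_midData (hc : ∀ j, ‖c j‖ = 1) :
    IsQuotientMap (fun d : midData ρ c s => (LensSpace.mk ρ d.1.1.1, LensSpace.mk ρ d.1.1.2)) :=
  ((LensSpace.isOpenQuotientMap_mk ρ).prodMap
    (LensSpace.isOpenQuotientMap_mk ρ)).isQuotientMap.comp
    ((isClosed_midData ρ c s).isQuotientMap_fst (exists_mem_midData ρ c s hc))

/-- The broken line of the index `k`. -/
noncomputable def midLine (d : midData ρ c s) (k : Fin N) (t : unitInterval) : EuclideanSpace ℂ (Fin n) :=
  polyline (c (s k).2) d.1.1.1 (d.1.2 k) (ρ (s k).1 d.1.1.2) t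

theorem continuous_midLine (k : Fin N) :
    Continuous fun q : midData ρ c s × unitInterval => midLine ρ c s q.1 k q.2 := by
  have hρ := (ρ (s k).1).continuous
  unfold midLine polyline
  fun_prop

variable {c}

theorem midLine_ne_zero (hc : ∀ j, ‖c j‖ = 1) (hc' : ∀ j, 0 ≤ (c j).re)
    (d : midData ρ c s) (k : Fin N) (t : unitInterval) : midLine ρ c s d k t ≠ 0 :=
  polyline_ne_zero (hc _) (hc' _) (norm_eq_of_mem_sphere _) (norm_eq_of_mem_sphere _)
    (norm_eq_of_mem_sphere (sphereAct ρ (s k).1 d.1.1.2)) (d.2 k) t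

/-- The central projection of the broken line to the sphere. -/
noncomputable def midPoint (hc : ∀ j, ‖c j‖ = 1) (hc' : ∀ j, 0 ≤ (c j).re) (d : midData ρ c s) (k : Fin N)
    (t : unitInterval) : Metric.sphere (0 : EuclideanSpace ℂ (Fin n)) 1 :=
  ⟨((‖midLine ρ c s d k t‖⁻¹ : ℝ) : ℂ) • midLine ρ c s d k t, by
    have h := norm_ne_zero_iff.2 (midLine_ne_zero ρ s hc hc' d k t)
    rw [mem_sphere_zero_iff_norm, norm_smul, Complex.norm_real, norm_inv, norm_norm,
      inv_mul_cancel₀ h]⟩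

theorem continuous_midPoint (hc : ∀ j, ‖c j‖ = 1) (hc' : ∀ j, 0 ≤ (c j).re) (k : Fin N) :
    Continuous fun q : midData ρ c s × unitInterval => midPoint ρ s hc hc' q.1 k q.2 := by
  have h := continuous_midLine ρ c s k
  refine Continuous.subtype_mk ((Complex.continuous_ofReal.comp (h.norm.inv₀ fun q => ?_)).smul h) _
  exact norm_ne_zero_iff.2 (midLine_ne_zero ρ s hc hc' q.1 k q.2)

theorem continuous_mk_midPoint (hc : ∀ j, ‖c j‖ = 1) (hc' : ∀ j, 0 ≤ (c j).re) (k : Fin N) :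
    Continuous fun q : midData ρ c s × unitInterval =>
      LensSpace.mk ρ (midPoint ρ s hc hc' q.1 k q.2) :=
  (LensSpace.isOpenQuotientMap_mk ρ).continuous.comp (continuous_midPoint ρ s hc hc' k)

/-- The path of the index `k` in the lens space. -/
noncomputable def midPath (hc : ∀ j, ‖c j‖ = 1) (hc' : ∀ j, 0 ≤ (c j).re) (d : midData ρ c s)
    (k : Fin N) : C(unitInterval, LensSpace ρ) :=
  ContinuousMap.curry ⟨_, continuous_mk_midPoint ρ s hc hc' k⟩ d

theorem continuous_midPath (hc : ∀ j, ‖c j‖ = 1) (hc' : ∀ j, 0 ≤ (c j).re) :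
    Continuous (midPath ρ s hc hc') :=
  continuous_pi fun _ => ContinuousMap.continuous _

theorem endPoints_midPath (hc : ∀ j, ‖c j‖ = 1) (hc' : ∀ j, 0 ≤ (c j).re) (d : midData ρ c s)
    (k : Fin N) : endPoints _ (midPath ρ s hc hc' d k) =
      (LensSpace.mk ρ d.1.1.1, LensSpace.mk ρ d.1.1.2) := by
  refine Prod.ext (congrArg (LensSpace.mk ρ) (Subtype.ext ?_)) ?_
  · simp [midPoint, midLine, polyline_zero]
  · refine Eq.trans (congrArg (LensSpace.mk ρ) (Subtype.ext ?_))
      (LensSpace.mk_sphereAct ρ (s k).1 d.1.1.2)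
    simp [midPoint, midLine, polyline_one, sphereAct]

variable (c)

/-- The weight of the index `k`, before normalization. -/
noncomputable def midWeight (z : Metric.sphere (0 : EuclideanSpace ℂ (Fin n)) 1 ×
    Metric.sphere (0 : EuclideanSpace ℂ (Fin n)) 1) (k : Fin N) : ℝ :=
  ‖c (s k).2 • (z.1 : EuclideanSpace ℂ (Fin n)) + ρ (s k).1 z.2‖

theorem continuous_midWeight : Continuous (midWeight ρ c s) := by
  refine continuous_pi fun k => ?_
  have hρ := (ρ (s k).1).continuous
  unfold midWeight
  fun_prop

theorem sum_midWeight_pos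
    (hpos : ∀ x y : Metric.sphere (0 : EuclideanSpace ℂ (Fin n)) 1, ∃ g j,
      c j • (x : EuclideanSpace ℂ (Fin n)) + ρ g y ≠ 0)
    (z : Metric.sphere (0 : EuclideanSpace ℂ (Fin n)) 1 ×
      Metric.sphere (0 : EuclideanSpace ℂ (Fin n)) 1) : 0 < ∑ k, midWeight ρ c s z k := by
  obtain ⟨g, j, h⟩ := hpos z.1 z.2
  refine Finset.sum_pos' (fun k _ => norm_nonneg _) ⟨s.symm (g, j), Finset.mem_univ _, ?_⟩
  simpa [midWeight] using h

/-- The normalized weights. -/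
noncomputable def midSimplex
    (hpos : ∀ x y : Metric.sphere (0 : EuclideanSpace ℂ (Fin n)) 1, ∃ g j,
      c j • (x : EuclideanSpace ℂ (Fin n)) + ρ g y ≠ 0)
    (z : Metric.sphere (0 : EuclideanSpace ℂ (Fin n)) 1 ×
      Metric.sphere (0 : EuclideanSpace ℂ (Fin n)) 1) : stdSimplex ℝ (Fin N) :=
  ⟨fun k => midWeight ρ c s z k / ∑ l, midWeight ρ c s z l,
    fun k => div_nonneg (norm_nonneg _) (sum_midWeight_pos ρ c s hpos z).le, by
      rw [← Finset.sum_div, div_self (sum_midWeight_pos ρ c s hpos z).ne']⟩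

theorem continuous_midSimplex
    (hpos : ∀ x y : Metric.sphere (0 : EuclideanSpace ℂ (Fin n)) 1, ∃ g j,
      c j • (x : EuclideanSpace ℂ (Fin n)) + ρ g y ≠ 0) :
    Continuous (midSimplex ρ c s hpos) := by
  have h := continuous_pi_iff.1 (continuous_midWeight ρ c s)
  refine Continuous.subtype_mk (continuous_pi fun k => (h k).div ?_ fun z => ?_) _
  · exact continuous_finsetSum _ fun l _ => h l
  · exact (sum_midWeight_pos ρ c s hpos z).ne'

/-- The permutation of the indices that corresponds to the translation of `x` by `h` and of `y`
by `l`. -/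
def translateIndex (h l : Multiplicative (ZMod p)) : Equiv.Perm (Fin N) :=
  s.trans ((((Equiv.mulLeft h⁻¹).trans (Equiv.mulRight l)).prodCongr (Equiv.refl J)).trans s.symm)

theorem apply_translateIndex (h l : Multiplicative (ZMod p)) (k : Fin N) :
    s (translateIndex s h l k) = (h⁻¹ * (s k).1 * l, (s k).2) := by
  simp only [translateIndex, Equiv.trans_apply, Equiv.apply_symm_apply]
  rfl

/-- This is `g * l = h * (h⁻¹ * g * l)`: up to a common translation by `h`, moving both lifts only
reindexes the group element. -/
theorem act_translateIndex (h l : Multiplicative (ZMod p)) (k : Fin N)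
    (y : Metric.sphere (0 : EuclideanSpace ℂ (Fin n)) 1) :
    ρ (s k).1 (sphereAct ρ l y) = ρ h (ρ (s (translateIndex s h l k)).1 y) := by
  have e : (s k).1 * l = h * (s (translateIndex s h l k)).1 := by
    rw [apply_translateIndex]
    group
  calc ρ (s k).1 (ρ l y) = (ρ (s k).1 * ρ l) y := rfl
    _ = (ρ h * ρ (s (translateIndex s h l k)).1) y := by rw [← map_mul, e, map_mul]
    _ = _ := rfl

theorem midWeight_translate (h l : Multiplicative (ZMod p))
    (z : Metric.sphere (0 : EuclideanSpace ℂ (Fin n)) 1 ×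
      Metric.sphere (0 : EuclideanSpace ℂ (Fin n)) 1) (k : Fin N) :
    midWeight ρ c s (sphereAct ρ h z.1, sphereAct ρ l z.2) k =
      midWeight ρ c s z (translateIndex s h l k) := by
  have e : (s (translateIndex s h l k)).2 = (s k).2 := by rw [apply_translateIndex]
  unfold midWeight
  rw [act_translateIndex ρ s h l, e]
  change ‖_ • ρ h z.1 + _‖ = _
  rw [← map_smul, ← map_add, (ρ h).norm_map]

variable {c}

/-- A nonzero weight makes the mid direction unique, so `ρ h` carries the mid direction of `d` to
that of `d'`. The whole broken line is then translated by `ρ h`, which is invisible in the lens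
space. -/
theorem midPath_translate (hc : ∀ j, ‖c j‖ = 1) (hc' : ∀ j, 0 ≤ (c j).re)
    (d d' : midData ρ c s) (h l : Multiplicative (ZMod p))
    (hx : sphereAct ρ h d.1.1.1 = d'.1.1.1) (hy : sphereAct ρ l d.1.1.2 = d'.1.1.2) (k : Fin N)
    (hk : midWeight ρ c s d'.1.1 k ≠ 0) :
    midPath ρ s hc hc' d' k = midPath ρ s hc hc' d (translateIndex s h l k) := by
  have e : (s (translateIndex s h l k)).2 = (s k).2 := by rw [apply_translateIndex]
  have ex : (d'.1.1.1 : EuclideanSpace ℂ (Fin n)) = ρ h d.1.1.1 := congrArg Subtype.val hx.symm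
  have ey : ρ (s k).1 d'.1.1.2 = ρ h (ρ (s (translateIndex s h l k)).1 d.1.1.2) := by
    rw [← hy]
    exact act_translateIndex ρ s h l k _
  have em : (d'.1.2 k : EuclideanSpace ℂ (Fin n)) = ρ h (d.1.2 (translateIndex s h l k)) := by
    have h1 := d'.2 k
    have h2 := (d.2 (translateIndex s h l k)).map (ρ h)
    rw [e, ← ex, ← ey] at h2
    exact h1.unique h2 (norm_ne_zero_iff.1 hk)
  ext t
  refine Eq.trans (congrArg (LensSpace.mk ρ) (Subtype.ext ?_))
    (LensSpace.mk_sphereAct ρ h (midPoint ρ s hc hc' d (translateIndex s h l k) t))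
  have hl : midLine ρ c s d' k t = ρ h (midLine ρ c s d (translateIndex s h l k) t) := by
    unfold midLine
    rw [ex, ey, em, map_polyline, e]
  change _ • midLine ρ c s d' k t = ρ h (_ • midLine ρ c s d (translateIndex s h l k) t)
  rw [hl, (ρ h).norm_map, map_smul]

/-- The measure on the paths of the lens space. -/
noncomputable def midMeasure (hc : ∀ j, ‖c j‖ = 1) (hc' : ∀ j, 0 ≤ (c j).re)
    (hpos : ∀ x y : Metric.sphere (0 : EuclideanSpace ℂ (Fin n)) 1, ∃ g j,
      c j • (x : EuclideanSpace ℂ (Fin n)) + ρ g y ≠ 0)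
    (d : midData ρ c s) : FinProb N C(unitInterval, LensSpace ρ) :=
  FinProb.ofFormalSum (midSimplex ρ c s hpos d.1.1, midPath ρ s hc hc' d)

theorem continuous_midMeasure (hc : ∀ j, ‖c j‖ = 1) (hc' : ∀ j, 0 ≤ (c j).re)
    (hpos : ∀ x y : Metric.sphere (0 : EuclideanSpace ℂ (Fin n)) 1, ∃ g j,
      c j • (x : EuclideanSpace ℂ (Fin n)) + ρ g y ≠ 0) :
    Continuous (midMeasure ρ s hc hc' hpos) :=
  continuous_coinduced_rng.comp (((continuous_midSimplex ρ c s hpos).comp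
    (by fun_prop)).prodMk (continuous_midPath ρ s hc hc'))

theorem midMeasure_eq (hc : ∀ j, ‖c j‖ = 1) (hc' : ∀ j, 0 ≤ (c j).re)
    (hpos : ∀ x y : Metric.sphere (0 : EuclideanSpace ℂ (Fin n)) 1, ∃ g j,
      c j • (x : EuclideanSpace ℂ (Fin n)) + ρ g y ≠ 0)
    (d d' : midData ρ c s) (hx : LensSpace.mk ρ d.1.1.1 = LensSpace.mk ρ d'.1.1.1)
    (hy : LensSpace.mk ρ d.1.1.2 = LensSpace.mk ρ d'.1.1.2) :
    midMeasure ρ s hc hc' hpos d = midMeasure ρ s hc hc' hpos d' := by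
  obtain ⟨h, hh⟩ := (LensSpace.mk_eq_mk_iff ρ).1 hx
  obtain ⟨l, hl⟩ := (LensSpace.mk_eq_mk_iff ρ).1 hy
  have hw : ∀ k, midWeight ρ c s d'.1.1 k = midWeight ρ c s d.1.1 (translateIndex s h l k) := by
    intro k
    rw [← midWeight_translate, hh, hl]
  have hsum : ∑ k, midWeight ρ c s d'.1.1 k = ∑ k, midWeight ρ c s d.1.1 k := by
    simp only [hw]
    exact Equiv.sum_comp (translateIndex s h l) (midWeight ρ c s d.1.1)
  refine Subtype.ext (Eq.symm ?_)
  change ∑ k, Finsupp.single (midPath ρ s hc hc' d' k)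
      (midWeight ρ c s d'.1.1 k / ∑ l, midWeight ρ c s d'.1.1 l) =
    ∑ k, Finsupp.single (midPath ρ s hc hc' d k)
      (midWeight ρ c s d.1.1 k / ∑ l, midWeight ρ c s d.1.1 l)
  refine Eq.trans ?_ (Equiv.sum_comp (translateIndex s h l) fun k =>
    Finsupp.single (midPath ρ s hc hc' d k)
      (midWeight ρ c s d.1.1 k / ∑ l, midWeight ρ c s d.1.1 l))
  refine Finset.sum_congr rfl fun k _ => ?_
  rw [hsum, ← hw]
  -- Where the weight is zero the two paths may differ, but neither contributes to the sum.
  by_cases hk : midWeight ρ c s d'.1.1 k = 0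
  · rw [hk, zero_div, Finsupp.single_zero, Finsupp.single_zero]
  · rw [midPath_translate ρ s hc hc' d d' h l hh hl k hk]

end Motion

/-! ### Descent to the lens space and the two bounds. -/

theorem FinProb.map_ofFormalSum_of_forall_eq {N : ℕ} [NeZero N] {X Y : Type*} (f : X → Y)
    (a : stdSimplex ℝ (Fin N) × (Fin N → X)) (y : Y) (h : ∀ i, f (a.2 i) = y) :
    FinProb.map f (FinProb.ofFormalSum a) = FinProb.dirac y := by
  refine Subtype.ext ?_
  change Finsupp.mapDomain f (∑ i, Finsupp.single (a.2 i) (a.1.1 i)) = Finsupp.single y 1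
  rw [Finsupp.mapDomain_finsetSum]
  simp only [Finsupp.mapDomain_single, h]
  rw [← Finsupp.single_finsetSum, a.1.2.2]

theorem admitsFinProbSection_endPoints_lensSpace {p n N : ℕ} [NeZero N] {J : Type*}
    (ρ : CyclicUnitaryAction p n) (c : J → ℂ) (s : Fin N ≃ Multiplicative (ZMod p) × J)
    (hc : ∀ j, ‖c j‖ = 1) (hc' : ∀ j, 0 ≤ (c j).re)
    (hpos : ∀ x y : Metric.sphere (0 : EuclideanSpace ℂ (Fin n)) 1, ∃ g j,
      c j • (x : EuclideanSpace ℂ (Fin n)) + ρ g y ≠ 0) :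
    AdmitsFinProbSection N (endPoints (LensSpace ρ)) := by
  have hq := isQuotientMap_midData ρ c s hc
  have hf : ∀ d d' : midData ρ c s,
      (LensSpace.mk ρ d.1.1.1, LensSpace.mk ρ d.1.1.2) =
        (LensSpace.mk ρ d'.1.1.1, LensSpace.mk ρ d'.1.1.2) →
      midMeasure ρ s hc hc' hpos d = midMeasure ρ s hc hc' hpos d' := fun d d' h =>
    midMeasure_eq ρ s hc hc' hpos d d' (congrArg Prod.fst h) (congrArg Prod.snd h)
  -- An arbitrary set-theoretic section is enough: the measure does not depend on the choice, and
  -- continuity is tested on `midData`.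
  let r := Function.surjInv hq.surjective
  have hr : ∀ d, midMeasure ρ s hc hc' hpos (r (LensSpace.mk ρ d.1.1.1, LensSpace.mk ρ d.1.1.2)) =
      midMeasure ρ s hc hc' hpos d := fun d => hf _ _ (Function.surjInv_eq hq.surjective _)
  refine ⟨fun z => midMeasure ρ s hc hc' hpos (r z), hq.continuous_iff.2 ?_, fun z => ?_⟩
  · exact (continuous_midMeasure ρ s hc hc' hpos).congr fun d => (hr d).symm
  · refine FinProb.map_ofFormalSum_of_forall_eq _ _ _ fun k => ?_
    exact (endPoints_midPath ρ s hc hc' (r z) k).trans (Function.surjInv_eq hq.surjective z)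

theorem dTC_le_of_admitsFinProbSection {X : Type*} [TopologicalSpace X] {k : ℕ}
    (h : AdmitsFinProbSection (k + 1) (endPoints X)) : dTC X ≤ k :=
  iInf₂_le k h

theorem mainTheorem5 (p n : ℕ) (hp : 1 ≤ p) (hn : 1 ≤ n) (ρ : CyclicUnitaryAction p n)
    (hρ : IsFreeOnSphere ρ) :
    (Odd p → dTC (LensSpace ρ) ≤ ((2 * p - 1 : ℕ) : ℕ∞)) ∧
      (Even p → dTC (LensSpace ρ) ≤ ((p - 1 : ℕ) : ℕ∞)) := by
  have : NeZero p := ⟨by omega⟩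
  refine ⟨fun _ => ?_, fun hp2 => ?_⟩
  · have hcard : Fintype.card (Fin (2 * p - 1 + 1)) =
        Fintype.card (Multiplicative (ZMod p) × Bool) := by
      simp only [Fintype.card_fin, Fintype.card_prod, Fintype.card_multiplicative, ZMod.card,
        Fintype.card_bool]
      omega
    refine dTC_le_of_admitsFinProbSection (admitsFinProbSection_endPoints_lensSpace ρ
      (fun b : Bool => if b then Complex.I else 1) (Fintype.equivOfCardEq hcard) ?_ ?_ ?_)
    · rintro (_ | _) <;> simp
    · rintro (_ | _) <;> simp
    · intro x y
      -- If every weight vanished, `g = 1` alone would give `x = -y = I • x`, impossible for a unit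
      -- vector.
      by_contra! h
      have h1 := h 1 false
      have h2 := h 1 true
      simp only [Bool.false_eq_true, if_false, if_true, one_smul] at h1 h2
      have h3 : (1 - Complex.I) • (x : EuclideanSpace ℂ (Fin n)) = 0 := by
        rw [sub_smul, one_smul, sub_eq_zero]
        exact add_right_cancel (h1.trans h2.symm)
      rcases smul_eq_zero.1 h3 with h4 | h4
      · simpa using congrArg Complex.re h4
      · exact ne_zero_of_mem_unit_sphere x h4
  · have hp1 : 1 < p := by
      obtain ⟨q, rfl⟩ := hp2
      omega
    have : Fact (1 < p) := ⟨hp1⟩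
    have hcard : Fintype.card (Fin (p - 1 + 1)) =
        Fintype.card (Multiplicative (ZMod p) × Unit) := by
      simp only [Fintype.card_fin, Fintype.card_prod, Fintype.card_multiplicative, ZMod.card,
        Fintype.card_unit]
      omega
    refine dTC_le_of_admitsFinProbSection (admitsFinProbSection_endPoints_lensSpace ρ
      (fun _ : Unit => 1) (Fintype.equivOfCardEq hcard) (by simp) (by simp) fun x y => ?_)
    -- If every weight vanished, every `ρ g y` would equal `-x`, so a nontrivial `g` would fix `y`.
    -- Evenness enters through `1 < p`, which supplies such a `g`.
    by_contra! h
    obtain ⟨g, hg⟩ := exists_ne (1 : Multiplicative (ZMod p))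
    have h1 := h 1 ()
    have h2 := h g ()
    refine hg (hρ g y y.2 ?_)
    have h3 := add_left_cancel (h2.trans h1.symm)
    simpa using h3
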